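/- Let $K$ be a field of characteristic zero, and let $n,k$ be nonnegative integers. On the ring $K[x][[t]]$ of formal power series in $t$ with coefficients in $K[x]$, define the operator $\Delta$ by $\Delta f=\frac{1}{x}\bigl(f(x,t)-f(0,t)\bigr)$, and let it act componentwise on vectors. Let $\mathbf a\in K[x][t]^n$ and $\mathbf B_0,\dots,\mathbf B_k\in K[x][t]^{n\times n}$. Then the functional equation $$\mathbf f=\mathbf a+t\sum_{i=0}^k \mathbf B_i\,\Delta^i\mathbf f$$ has a unique solution $\mathbf f$ in $K[x][[t]]^n$, and every component of this solution is algebraic over $K[x,t]$. -/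

import Mathlib

open scoped Polynomial PowerSeries

namespace CatalyticSystem

/-- Substitution `x = 0` on `K[x][[t]]`: the series `f(0, t)`, regarded again as an element of
`K[x][[t]]`. The inner variable is `x`, and the power series variable is `t`. -/
noncomputable def evalZero {K : Type*} [Field K] (f : K[X]⟦X⟧) : K[X]⟦X⟧ :=
  PowerSeries.map (Polynomial.C.comp (Polynomial.evalRingHom (0 : K))) f

/-- The operator `Δ f = (f(x, t) - f(0, t)) / x` on `K[x][[t]]`. The division by `x` is performed
on each coefficient with respect to `t`: `Polynomial.divX p = (p(x) - p(0)) / x`. -/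
noncomputable def delta {K : Type*} [Field K] (f : K[X]⟦X⟧) : K[X]⟦X⟧ :=
  PowerSeries.mk fun m => (PowerSeries.coeff m f).divX

/-- `x * Δ f = f(x, t) - f(0, t)`, which determines `Δ f`, as `K[x][[t]]` is a domain. -/
theorem X_mul_delta {K : Type*} [Field K] (f : K[X]⟦X⟧) :
    PowerSeries.C (Polynomial.X : K[X]) * delta f = f - evalZero f := by
  ext1 m
  rw [PowerSeries.coeff_C_mul, map_sub, delta, evalZero, PowerSeries.coeff_mk,
    PowerSeries.coeff_map, eq_sub_iff_add_eq]
  conv_rhs => rw [← Polynomial.X_mul_divX_add (PowerSeries.coeff m f)]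
  simp [Polynomial.coeff_zero_eq_eval_zero]

/-- `f ∈ K[x][[t]]^n` solves the functional equation `f = a + t * ∑_{i=0}^k B_i Δ^i f`,
where `K[x][t]` is `K[X][X]` with outer variable `t`, and `Δ` acts componentwise. -/
def IsSolution {K : Type*} [Field K] {n k : ℕ} (a : Fin n → K[X][X])
    (B : Fin (k + 1) → Matrix (Fin n) (Fin n) K[X][X]) (f : Fin n → K[X]⟦X⟧) : Prop :=
  f = (fun j => (a j : K[X]⟦X⟧)) +
    (PowerSeries.X : K[X]⟦X⟧) • ∑ i : Fin (k + 1),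
      Matrix.mulVec ((B i).map fun b => (b : K[X]⟦X⟧)) (fun j => delta^[(i : ℕ)] (f j))

end CatalyticSystem

/-! Existence and uniqueness are t-adic: Δ does not lower the order in t, so the factor t makes the
right-hand side a contraction (`kernelOp_injective`, `kernelOp_surjective`).

For algebraicity, write f = ∑_{i<k} r_i(t) x^i + x^k h with h = Δ^k f. On x^k h the operators Δ^i
only lower the power of x, so the equation reads P h = a - (image of the low part), with P = x^k - t
∑ x^(k-i) B_i. Multiplication by the adjugate gives det P · h = (adj P) a - ∑ r_q c_q, with c_q
polynomial. As det P ≡ x^(kn) mod t, Weierstrass preparation gives det P = W · unit with W monic of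
degree kn in x; its coefficients are algebraic over K[t], since its roots are roots of det P. Hence
W divides the right-hand side, and reduction modulo W is a linear system for the kn series r_q with
algebraic coefficients.

The crux is that this system has trivial kernel: if W divides every component of ∑ v_q c_q, then the
low part built from v has the same image as some x^k h. Injectivity makes them equal, and degrees in
x force v = 0. So r is algebraic, then h, then f. -/

namespace CatalyticSystem

/-! ### Algebraic coefficients of factors, linear systems over a domain, Weierstrass preparation -/

open Polynomial in
/-- The coefficients of a monic factor of a nonzero polynomial are algebraic over any domain which
contains the coefficients of that polynomial. -/
theorem isAlgebraic_coeff_of_monic_dvd_map {A R : Type*} [CommRing A] [IsDomain A] [CommRing R]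
    [IsDomain R] [Algebra A R] {D : A[X]}
    (hD : D ≠ 0) {W : R[X]} (hW : W.Monic) (hdvd : W ∣ D.map (algebraMap A R)) (i : ℕ) :
    IsAlgebraic A (W.coeff i) := by
  let Ω := AlgebraicClosure (FractionRing R)
  have hRΩ : Function.Injective (algebraMap R Ω) := by
    rw [IsScalarTower.algebraMap_eq R (FractionRing R) Ω]
    exact (algebraMap (FractionRing R) Ω).injective.comp (IsFractionRing.injective R _)
  let T := Subalgebra.algebraicClosure A Ω
  have hsplit := IsAlgClosed.splits (W.map (algebraMap R Ω))
  have hprod := hsplit.eq_prod_roots_of_monic (hW.map _)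
  -- Every root of `W` is a root of `D`, so each linear factor is defined over the algebraic closure
  -- `T` of `A` in `Ω`.
  have hmem : W.map (algebraMap R Ω) ∈ lifts (algebraMap T Ω) := by
    rw [hprod]
    refine Submonoid.multiset_prod_mem (lifts (algebraMap T Ω)).toSubmonoid _ fun p hp => ?_
    obtain ⟨z, hz, rfl⟩ := Multiset.mem_map.mp hp
    have hroot : IsAlgebraic A z := by
      refine ⟨D, hD, ?_⟩
      have h1 : (W.map (algebraMap R Ω)).eval z = 0 := (mem_roots'.mp hz).2
      obtain ⟨q, hq⟩ := hdvd
      have h2 := congrArg (fun p => (p.map (algebraMap R Ω)).eval z) hq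
      simp only [Polynomial.map_mul, eval_mul, h1, zero_mul, Polynomial.map_map,
        ← IsScalarTower.algebraMap_eq A R Ω] at h2
      rwa [aeval_def, ← eval_map]
    exact ⟨X - C (⟨z, hroot⟩ : T), by
      rw [coe_mapRingHom, Polynomial.map_sub, map_X, map_C]
      rfl⟩
  have hc := (lifts_iff_coeff_lifts _).mp hmem i
  rw [coeff_map] at hc
  obtain ⟨c, hc⟩ := hc
  have : IsAlgebraic A (algebraMap R Ω (W.coeff i)) := by rw [← hc]; exact c.2
  exact (isAlgebraic_algebraMap_iff hRΩ).mp this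

/-- A linear system over a domain `A` with trivial kernel: a solution in an extension ring has
coordinates in the fraction field of `A`. -/
theorem exists_mul_eq_algebraMap_of_mulVec_eq {A R I J : Type*} [CommRing A] [IsDomain A]
    [CommRing R] [Algebra A R] [Fintype I] [Fintype J]
    (M : Matrix I J A) (hM : ∀ v : J → A, M.mulVec v = 0 → v = 0) (b : I → A) (r : J → R)
    (hr : (M.map (algebraMap A R)).mulVec r = fun i => algebraMap A R (b i)) :
    ∃ d : A, d ≠ 0 ∧ ∀ j, ∃ c : A, algebraMap A R d * r j = algebraMap A R c := by
  classical
  let F := FractionRing A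
  have hF : ∀ v : J → F, (M.map (algebraMap A F)).mulVec v = 0 → v = 0 := by
    intro v hv
    obtain ⟨d, hd⟩ := IsLocalization.exist_integer_multiples_of_finset (nonZeroDivisors A)
      (Finset.univ.image v)
    have hd' : ∀ j, ∃ c : A, algebraMap A F c = algebraMap A F d * v j := fun j => by
      obtain ⟨c, hc⟩ := hd (v j) (Finset.mem_image_of_mem _ (Finset.mem_univ j))
      exact ⟨c, by rw [hc, Algebra.smul_def]⟩
    choose c hc using hd'
    have hc0 : c = 0 := by
      refine hM c (funext fun i => IsFractionRing.injective A F ?_)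
      have := congrFun hv i
      simp only [Matrix.mulVec, dotProduct, Matrix.map_apply, Pi.zero_apply] at this
      simp only [Matrix.mulVec, dotProduct, map_sum, map_mul, hc, Pi.zero_apply, map_zero]
      rw [← mul_zero (algebraMap A F d), ← this, Finset.mul_sum]
      exact Finset.sum_congr rfl fun j _ => by ring
    funext j
    have h := hc j
    rw [hc0, Pi.zero_apply, map_zero] at h
    have hd0 : algebraMap A F d ≠ 0 := by
      simp
    exact (mul_eq_zero.mp h.symm).resolve_left hd0
  -- A left inverse over the fraction field, cleared of denominators, gives `N' * M = d • 1` over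
  -- `A`, an identity that can be transported to `R`.
  obtain ⟨g, hg⟩ := (Matrix.toLin' (M.map (algebraMap A F))).exists_leftInverse_of_injective
    (LinearMap.ker_eq_bot'.mpr fun v hv => hF v (by simpa using hv))
  let N : Matrix J I F := LinearMap.toMatrix' g
  have hN : N * M.map (algebraMap A F) = 1 := by
    have h := congrArg LinearMap.toMatrix' hg
    rwa [LinearMap.toMatrix'_comp, LinearMap.toMatrix'_toLin', LinearMap.toMatrix'_id] at h
  obtain ⟨d, hd⟩ := IsLocalization.exist_integer_multiples_of_finset (nonZeroDivisors A)
    (Finset.univ.image fun p : J × I => N p.1 p.2)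
  have hd' : ∀ j i, ∃ c : A, algebraMap A F c = algebraMap A F d * N j i := fun j i => by
    obtain ⟨c, hc⟩ := hd (N j i) (Finset.mem_image_of_mem (fun p : J × I => N p.1 p.2)
      (Finset.mem_univ (j, i)))
    exact ⟨c, by rw [hc, Algebra.smul_def]⟩
  choose N' hN' using hd'
  have hNM : Matrix.of N' * M = (d : A) • 1 := by
    ext j j'
    refine IsFractionRing.injective A F ?_
    have := congrFun (congrFun hN j) j'
    simp only [Matrix.mul_apply, Matrix.map_apply] at this
    simp only [Matrix.mul_apply, map_sum, map_mul, Matrix.of_apply, hN', Matrix.smul_apply,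
      smul_eq_mul, mul_assoc, ← Finset.mul_sum, this]
    by_cases h : j = j'
    · subst h; simp
    · simp [h]
  refine ⟨d, nonZeroDivisors.ne_zero d.2, fun j => ⟨(Matrix.of N').mulVec b j, ?_⟩⟩
  have h1 : (Matrix.of N' * M).map (algebraMap A R) =
      (Matrix.of N').map (algebraMap A R) * M.map (algebraMap A R) := Matrix.map_mul
  have h2 : ((Matrix.of N' * M).map (algebraMap A R)).mulVec r j = algebraMap A R d * r j := by
    have : ((d : A) • (1 : Matrix J J A)).map (algebraMap A R) = algebraMap A R d • 1 := by
      ext p q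
      by_cases h : p = q <;> simp [h]
    rw [hNM, this]
    rw [Matrix.smul_mulVec, Matrix.one_mulVec, Pi.smul_apply, smul_eq_mul]
  rw [← h2, h1, ← Matrix.mulVec_mulVec, hr]
  simp [Matrix.mulVec, dotProduct]

open PowerSeries in
/-- Polynomial form of the Weierstrass preparation theorem over `K[[t]]`. -/
theorem exists_monic_factor {K : Type*} [Field K] (D : K⟦X⟧[X]) (N : ℕ)
    (hD : D.map constantCoeff = Polynomial.X ^ N) :
    ∃ W u : K⟦X⟧[X], W.Monic ∧ D = W * u ∧ W.map constantCoeff = Polynomial.X ^ N ∧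
      u.map (constantCoeff (R := K)) = 1 ∧ W.natDegree = N := by
  have hmax : IsLocalRing.maximalIdeal K⟦X⟧ = Ideal.span {X} := maximalIdeal_eq_span_X
  have hcomp : IsAdicComplete (IsLocalRing.maximalIdeal K⟦X⟧) K⟦X⟧ := by
    rw [hmax]; infer_instance
  have hne : (D : K⟦X⟧⟦X⟧).map (IsLocalRing.residue K⟦X⟧) ≠ 0 := by
    intro h
    have h1 := congrArg (PowerSeries.coeff N) h
    rw [coeff_map, map_zero, Polynomial.coeff_coe, IsLocalRing.residue_eq_zero_iff, hmax,
      Ideal.mem_span_singleton, X_dvd_iff] at h1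
    have h2 := congrArg (fun p => Polynomial.coeff p N) hD
    simp [h1] at h2
  obtain ⟨W, u, hWu⟩ := exists_isWeierstrassFactorization hne
  have hmonic : W.Monic := hWu.isDistinguishedAt.monic
  have hWbar : W.map (constantCoeff (R := K)) = Polynomial.X ^ W.natDegree := by
    ext i
    rw [Polynomial.coeff_map, Polynomial.coeff_X_pow]
    rcases lt_trichotomy i W.natDegree with h | h | h
    · have := hWu.isDistinguishedAt.mem h
      rw [hmax, Ideal.mem_span_singleton, X_dvd_iff] at this
      rw [this, if_neg h.ne]
    · rw [if_pos h, h, hmonic.coeff_natDegree, map_one]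
    · rw [Polynomial.coeff_eq_zero_of_natDegree_lt h, if_neg h.ne', map_zero]
  have hcW : (W : K⟦X⟧⟦X⟧).IsWeierstrassDivisorAt (IsLocalRing.maximalIdeal K⟦X⟧) :=
    hWu.isDistinguishedAt.isWeierstrassDivisorAt'
  have hdegW : ((W : K⟦X⟧⟦X⟧).map
      (Ideal.Quotient.mk (IsLocalRing.maximalIdeal K⟦X⟧))).order.toNat = W.natDegree := by
    rw [← hWu.isDistinguishedAt.coe_natDegree_eq_order_map W 1 (by simp) (by simp),
      ENat.toNat_natCast]
  have hDW : D = W * (D /ₘ W) + D %ₘ W := by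
    rw [add_comm]; exact (Polynomial.modByMonic_add_div D W).symm
  have hlt : (D %ₘ W).degree < ((W : K⟦X⟧⟦X⟧).map
      (Ideal.Quotient.mk (IsLocalRing.maximalIdeal K⟦X⟧))).order.toNat := by
    rw [hdegW, ← Polynomial.degree_eq_natDegree hmonic.ne_zero]
    exact Polynomial.degree_modByMonic_lt D hmonic
  -- Polynomial division is also a Weierstrass division, so uniqueness of the latter shows that the
  -- power series `u` is a polynomial.
  have hzero : D %ₘ W = 0 ∧ u = ((D /ₘ W : K⟦X⟧[X]) : K⟦X⟧⟦X⟧) := by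
    have h := hcW.eq_of_mul_add_eq_mul_add (q := u) (q' := ((D /ₘ W : K⟦X⟧[X]) : K⟦X⟧⟦X⟧))
      (r := 0) (r' := D %ₘ W) (by simp) hlt (by
        rw [Polynomial.coe_zero, add_zero, ← hWu.eq_mul, ← Polynomial.coe_mul,
          ← Polynomial.coe_add, ← hDW])
    exact ⟨h.2.symm, h.1⟩
  rw [hzero.1, add_zero] at hDW
  have hbar := congrArg (Polynomial.map (constantCoeff (R := K))) hDW
  rw [hD, Polynomial.map_mul, hWbar] at hbar
  have hunit : ((D /ₘ W).map (constantCoeff (R := K))).coeff 0 ≠ 0 := by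
    have h := hWu.isUnit.map (constantCoeff (R := K⟦X⟧))
    rw [hzero.2, Polynomial.constantCoeff_coe] at h
    rw [Polynomial.coeff_map]
    exact (h.map (constantCoeff (R := K))).ne_zero
  have hN : W.natDegree = N := by
    have h1 : W.natDegree ≤ N :=
      (pow_dvd_pow_iff Polynomial.X_ne_zero Polynomial.not_isUnit_X).mp ⟨_, hbar⟩
    obtain ⟨e, rfl⟩ := Nat.exists_eq_add_of_le h1
    rw [pow_add] at hbar
    have h2 := mul_left_cancel₀ (pow_ne_zero _ Polynomial.X_ne_zero) hbar
    rw [← h2] at hunit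
    rcases Nat.eq_zero_or_pos e with rfl | he
    · rfl
    · simp [Polynomial.coeff_X_pow, he.ne] at hunit
  refine ⟨W, D /ₘ W, hmonic, hDW, hN ▸ hWbar, ?_, hN⟩
  rw [hN] at hbar
  exact (mul_left_cancel₀ (pow_ne_zero N Polynomial.X_ne_zero) (by rw [← hbar, mul_one])).symm

/-! ### The operator Δ and Taylor expansion in x -/

open PowerSeries (X C coeff)

variable {K : Type*} [Field K]

theorem coeff_delta (f : K[X]⟦X⟧) (m : ℕ) : coeff m (delta f) = (coeff m f).divX := by
  rw [delta, PowerSeries.coeff_mk]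

theorem delta_add (f g : K[X]⟦X⟧) : delta (f + g) = delta f + delta g := by
  ext1 m
  simp only [map_add, coeff_delta, Polynomial.divX_add]

theorem delta_zero : delta (0 : K[X]⟦X⟧) = 0 := by
  ext1 m
  simp [coeff_delta]

/-- The inclusion `K[[t]] → K[x][[t]]`. -/
noncomputable def const : K⟦X⟧ →+* K[X]⟦X⟧ := PowerSeries.map Polynomial.C

/-- The element `x` of `K[x][[t]]`. -/
noncomputable def x : K[X]⟦X⟧ := C (Polynomial.X : K[X])

theorem x_ne_zero : (x : K[X]⟦X⟧) ≠ 0 := by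
  intro h
  have := congrArg (coeff 0) h
  simp [x] at this

/-- The substitution `x = 0` as a map `K[x][[t]] → K[[t]]`. -/
noncomputable def atZero : K[X]⟦X⟧ →+* K⟦X⟧ := PowerSeries.map (Polynomial.evalRingHom 0)

theorem const_atZero (f : K[X]⟦X⟧) : const (atZero f) = evalZero f := by
  ext1 m
  simp [const, atZero, evalZero]

theorem x_mul_delta (f : K[X]⟦X⟧) : x * delta f = f - const (atZero f) := by
  rw [const_atZero]; exact X_mul_delta f

theorem atZero_const (s : K⟦X⟧) : atZero (const s) = s := by
  ext m
  simp [const, atZero]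

theorem delta_const_mul (s : K⟦X⟧) (f : K[X]⟦X⟧) : delta (const s * f) = const s * delta f := by
  apply mul_left_cancel₀ x_ne_zero
  rw [x_mul_delta, mul_left_comm, x_mul_delta, map_mul, map_mul, atZero_const, mul_sub]

theorem delta_x_mul (f : K[X]⟦X⟧) : delta (x * f) = f := by
  apply mul_left_cancel₀ x_ne_zero
  rw [x_mul_delta, map_mul]
  simp [atZero, x]

theorem delta_C (p : K[X]) : delta (C p) = C p.divX := by
  ext1 m
  rw [coeff_delta, PowerSeries.coeff_C, PowerSeries.coeff_C]
  split_ifs <;> simp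

theorem X_pow_dvd_delta {m : ℕ} {f : K[X]⟦X⟧} (h : X ^ m ∣ f) : X ^ m ∣ delta f := by
  rw [PowerSeries.X_pow_dvd_iff] at h ⊢
  intro i hi
  rw [coeff_delta, h i hi, Polynomial.divX_zero]

/-- The iterate `Δ^i` as an additive map. -/
noncomputable def deltaPow (i : ℕ) : K[X]⟦X⟧ →+ K[X]⟦X⟧ where
  toFun := delta^[i]
  map_zero' := Function.iterate_fixed delta_zero i
  map_add' := by
    induction i with
    | zero => intro f g; rfl
    | succ i ih => intro f g; simp only [Function.iterate_succ_apply', ih, delta_add]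

theorem deltaPow_zero (f : K[X]⟦X⟧) : deltaPow 0 f = f := rfl

theorem deltaPow_succ (i : ℕ) (f : K[X]⟦X⟧) : deltaPow (i + 1) f = delta (deltaPow i f) :=
  Function.iterate_succ_apply' _ _ _

theorem deltaPow_const_mul (i : ℕ) (s : K⟦X⟧) (f : K[X]⟦X⟧) :
    deltaPow i (const s * f) = const s * deltaPow i f := by
  induction i with
  | zero => rfl
  | succ i ih => rw [deltaPow_succ, ih, delta_const_mul, deltaPow_succ]

/-- With enough factors x no value at x = 0 is subtracted; this is what turns the operator into a
matrix. -/
theorem deltaPow_x_pow_mul {i k : ℕ} (h : i ≤ k) (f : K[X]⟦X⟧) :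
    deltaPow i (x ^ k * f) = x ^ (k - i) * f := by
  induction i with
  | zero => rfl
  | succ i ih =>
    rw [deltaPow_succ, ih (by omega), show k - i = k - (i + 1) + 1 by omega, pow_succ', mul_assoc,
      delta_x_mul]

theorem deltaPow_C (i : ℕ) (p : K[X]) : deltaPow i (C p) = C (Polynomial.divX^[i] p) := by
  induction i with
  | zero => rfl
  | succ i ih => rw [deltaPow_succ, ih, delta_C, Function.iterate_succ_apply']

theorem X_pow_dvd_deltaPow {m : ℕ} (i : ℕ) {f : K[X]⟦X⟧} (h : X ^ m ∣ f) :
    X ^ m ∣ deltaPow i f := by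
  induction i with
  | zero => exact h
  | succ i ih => rw [deltaPow_succ]; exact X_pow_dvd_delta ih

/-- Taylor expansion in `x` at order `k`, with remainder `x^k Δ^k f`. -/
theorem sum_add_x_pow_mul_deltaPow (k : ℕ) (f : K[X]⟦X⟧) :
    ∑ i : Fin k, const (atZero (deltaPow i f)) * x ^ (i : ℕ) + x ^ k * deltaPow k f = f := by
  induction k with
  | zero => simp [deltaPow_zero]
  | succ k ih =>
    conv_rhs => rw [← ih]
    rw [Fin.sum_univ_castSucc, deltaPow_succ, pow_succ, mul_assoc, x_mul_delta]
    simp only [Fin.val_castSucc, Fin.val_last]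
    ring

theorem eq_zero_of_X_pow_dvd {f : K[X]⟦X⟧} (h : ∀ m, X ^ m ∣ f) : f = 0 := by
  ext1 m
  exact PowerSeries.X_pow_dvd_iff.mp (h (m + 1)) m (Nat.lt_succ_self m)

/-! ### The operator f ↦ f - t ∑ B_i Δ^i f and its kernel matrix -/

section Operator

variable {n k : ℕ}

/-- The inclusion `K[x][t] → K[x][[t]]`. -/
noncomputable abbrev coePS : K[X][X] →+* K[X]⟦X⟧ := Polynomial.coeToPowerSeries.ringHom

theorem coePS_C (p : K[X]) : coePS (Polynomial.C p) = C p := by simp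

theorem coePS_X : coePS (Polynomial.X : K[X][X]) = X := by simp

/-- The additive operator `f ↦ ∑ B_i Δ^i f`. -/
noncomputable def sumOp (B : Fin (k + 1) → Matrix (Fin n) (Fin n) K[X][X]) :
    (Fin n → K[X]⟦X⟧) →+ (Fin n → K[X]⟦X⟧) where
  toFun f := ∑ i : Fin (k + 1), ((B i).map coePS).mulVec fun j => deltaPow i (f j)
  map_zero' := by
    refine Finset.sum_eq_zero fun i _ => ?_
    simp only [Pi.zero_apply, map_zero]
    exact Matrix.mulVec_zero _
  map_add' f g := by
    rw [← Finset.sum_add_distrib]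
    refine Finset.sum_congr rfl fun i _ => ?_
    rw [← Matrix.mulVec_add]
    simp only [Pi.add_apply, map_add]
    rfl

/-- The operator `f ↦ f - t ∑ B_i Δ^i f`. -/
noncomputable def kernelOp (B : Fin (k + 1) → Matrix (Fin n) (Fin n) K[X][X]) :
    (Fin n → K[X]⟦X⟧) →+ (Fin n → K[X]⟦X⟧) where
  toFun f := f - (X : K[X]⟦X⟧) • sumOp B f
  map_zero' := by simp
  map_add' f g := by rw [map_add, smul_add]; abel

variable (B : Fin (k + 1) → Matrix (Fin n) (Fin n) K[X][X])

theorem sumOp_apply (f : Fin n → K[X]⟦X⟧) (j : Fin n) :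
    sumOp B f j = ∑ i : Fin (k + 1), ∑ l, coePS (B i j l) * deltaPow i (f l) := by
  simp [sumOp, Finset.sum_apply, Matrix.mulVec, dotProduct]

theorem kernelOp_apply (f : Fin n → K[X]⟦X⟧) (j : Fin n) :
    kernelOp B f j = f j - X * sumOp B f j := rfl

theorem isSolution_iff (a : Fin n → K[X][X]) (f : Fin n → K[X]⟦X⟧) :
    IsSolution a B f ↔ kernelOp B f = fun j => coePS (a j) := by
  change _ ↔ f - (X : K[X]⟦X⟧) • sumOp B f = _
  rw [sub_eq_iff_eq_add]
  rfl

theorem X_pow_dvd_sumOp {m : ℕ} {f : Fin n → K[X]⟦X⟧} (h : ∀ j, X ^ m ∣ f j) (j : Fin n) :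
    X ^ m ∣ sumOp B f j := by
  rw [sumOp_apply]
  exact Finset.dvd_sum fun i _ => Finset.dvd_sum fun l _ =>
    Dvd.dvd.mul_left (X_pow_dvd_deltaPow i (h l)) _

/-- An element f of the kernel equals t times `sumOp B f`, so divisibility by t^m improves to
t^(m+1). -/
theorem kernelOp_injective : Function.Injective (kernelOp B) := by
  rw [injective_iff_map_eq_zero]
  intro f hf
  have key : ∀ m j, X ^ m ∣ f j := by
    intro m
    induction m with
    | zero => intro j; simp
    | succ m ih =>
      intro j
      have h := congrFun hf j
      rw [kernelOp_apply, Pi.zero_apply, sub_eq_zero] at h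
      rw [h, pow_succ']
      exact mul_dvd_mul_left _ (X_pow_dvd_sumOp B ih j)
  exact funext fun j => eq_zero_of_X_pow_dvd fun m => key m j

theorem kernelOp_surjective : Function.Surjective (kernelOp B) := by
  intro a
  let F : (Fin n → K[X]⟦X⟧) → (Fin n → K[X]⟦X⟧) := fun f => a + (X : K[X]⟦X⟧) • sumOp B f
  have hF : ∀ m f g, (∀ j, X ^ m ∣ f j - g j) → ∀ j, X ^ (m + 1) ∣ F f j - F g j := by
    intro m f g h j
    have : F f j - F g j = X * sumOp B (f - g) j := by
      rw [map_sub]; simp [F, mul_sub]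
    rw [this, pow_succ']
    exact mul_dvd_mul_left _ (X_pow_dvd_sumOp B h j)
  have hstep : ∀ m e j, X ^ m ∣ F^[m + e] 0 j - F^[m] 0 j := by
    intro m
    induction m with
    | zero => simp
    | succ m ih =>
      intro e
      rw [show m + 1 + e = m + e + 1 by omega, Function.iterate_succ_apply',
        Function.iterate_succ_apply']
      exact hF m _ _ (ih e)
  -- The coefficient of t^m no longer changes from iterate m + 1 on.
  let f : Fin n → K[X]⟦X⟧ := fun j => PowerSeries.mk fun m => coeff m (F^[m + 1] 0 j)
  have hf : ∀ m j, X ^ m ∣ f j - F^[m] 0 j := by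
    intro m j
    rw [PowerSeries.X_pow_dvd_iff]
    intro i hi
    obtain ⟨e, rfl⟩ := Nat.exists_eq_add_of_lt hi
    have h := PowerSeries.X_pow_dvd_iff.mp (hstep (i + 1) e j) i (Nat.lt_succ_self i)
    rw [show i + 1 + e = i + e + 1 by omega, map_sub, sub_eq_zero] at h
    rw [map_sub, PowerSeries.coeff_mk, h, sub_self]
  refine ⟨f, ?_⟩
  have hfix : ∀ j, f j - F f j = 0 := fun j => by
    refine eq_zero_of_X_pow_dvd fun m => ?_
    have h1 := (pow_dvd_pow X (Nat.le_succ m)).trans (hf (m + 1) j)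
    have h2 := (pow_dvd_pow X (Nat.le_succ m)).trans (hF m _ _ (hf m) j)
    rw [Function.iterate_succ_apply'] at h1
    have := dvd_sub h1 h2
    rwa [sub_sub_sub_cancel_right] at this
  funext j
  have h := hfix j
  simp only [F, Pi.add_apply, Pi.smul_apply, smul_eq_mul] at h
  rw [kernelOp_apply]
  linear_combination h

theorem kernelOp_const_mul (s : K⟦X⟧) (f : Fin n → K[X]⟦X⟧) (j : Fin n) :
    kernelOp B (fun l => const s * f l) j = const s * kernelOp B f j := by
  simp only [kernelOp_apply, sumOp_apply, deltaPow_const_mul, mul_sub, Finset.mul_sum]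
  exact congrArg _ (Finset.sum_congr rfl fun i _ => Finset.sum_congr rfl fun l _ => by ring)

/-- Needed for the monomials x^i e_j: it keeps the linear system for the unknown series over
K[x][t]. -/
theorem exists_kernelOp_C (v : Fin n → K[X]) :
    ∃ y : Fin n → K[X][X], kernelOp B (fun j => C (v j)) = fun j => coePS (y j) := by
  refine ⟨fun j => Polynomial.C (v j) - Polynomial.X * ∑ i : Fin (k + 1), ∑ l,
    B i j l * Polynomial.C (Polynomial.divX^[i] (v l)), funext fun j => ?_⟩
  rw [kernelOp_apply, sumOp_apply]
  simp only [map_sub, map_mul, map_sum, deltaPow_C, coePS_C, coePS_X]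

/-- The kernel matrix `x^k - t ∑ x^(k-i) B_i`. -/
noncomputable def kernelMatrix : Matrix (Fin n) (Fin n) K[X][X] :=
  (Polynomial.C Polynomial.X : K[X][X]) ^ k • 1 - (Polynomial.X : K[X][X]) •
    ∑ i : Fin (k + 1), (Polynomial.C Polynomial.X : K[X][X]) ^ (k - (i : ℕ)) • B i

theorem kernelOp_x_pow_mul (h : Fin n → K[X]⟦X⟧) :
    kernelOp B (fun j => x ^ k * h j) = ((kernelMatrix B).map coePS).mulVec h := by
  funext j
  rw [kernelOp_apply, sumOp_apply]
  have h1 : ∀ i : Fin (k + 1), ∀ l, deltaPow (i : ℕ) (x ^ k * h l) = x ^ (k - (i : ℕ)) * h l :=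
    fun i l => deltaPow_x_pow_mul (Nat.lt_succ_iff.mp i.2) _
  have hx : coePS (Polynomial.C Polynomial.X : K[X][X]) = x := coePS_C _
  have h2 : ∀ l, coePS (kernelMatrix B j l) = x ^ k * (1 : Matrix (Fin n) (Fin n) K[X]⟦X⟧) j l -
      X * ∑ i : Fin (k + 1), x ^ (k - (i : ℕ)) * coePS (B i j l) := fun l => by
    have h3 : coePS ((1 : Matrix (Fin n) (Fin n) K[X][X]) j l) =
        (1 : Matrix (Fin n) (Fin n) K[X]⟦X⟧) j l := by
      simp only [Matrix.one_apply]; split_ifs <;> simp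
    rw [kernelMatrix, Matrix.sub_apply, Matrix.smul_apply, Matrix.smul_apply, Matrix.sum_apply]
    simp only [Matrix.smul_apply, smul_eq_mul]
    rw [map_sub, map_mul, map_mul, map_sum, map_pow, hx, coePS_X, h3]
    simp only [map_mul, map_pow, hx]
  simp only [h1, Matrix.mulVec, dotProduct, Matrix.map_apply, h2, sub_mul, Finset.sum_sub_distrib]
  refine congrArg₂ (· - ·) ?_ ?_
  · simp [Matrix.one_apply]
  · rw [Finset.sum_comm, Finset.mul_sum]
    refine Finset.sum_congr rfl fun l _ => ?_
    rw [mul_assoc, Finset.sum_mul]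
    exact congrArg _ (Finset.sum_congr rfl fun i _ => by ring)

/-- Modulo t the kernel matrix is x^k times the identity. This makes the determinant nonzero and
fixes its Weierstrass degree. -/
theorem det_kernelMatrix_eval_zero :
    (kernelMatrix B).det.eval 0 = (Polynomial.X : K[X]) ^ (k * n) := by
  have h := (Polynomial.evalRingHom (0 : K[X])).map_det (kernelMatrix B)
  rw [Polynomial.coe_evalRingHom] at h
  rw [h]
  have h2 : (Polynomial.evalRingHom (0 : K[X])).mapMatrix (kernelMatrix B) =
      (Polynomial.X : K[X]) ^ k • 1 := by
    ext1 j l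
    simp [kernelMatrix, Matrix.one_apply, apply_ite (Polynomial.eval (0 : K[X]))]
  rw [h2, Matrix.det_smul, Matrix.det_one, mul_one, Fintype.card_fin, pow_mul]

end Operator

/-! ### Comparison of K[x][t], K[[t]][x] and K[x][[t]] -/

/-- The inclusion `K[[t]][x] → K[x][[t]]`. -/
noncomputable def ofPoly : K⟦X⟧[X] →+* K[X]⟦X⟧ := Polynomial.eval₂RingHom const x

/-- The inclusion `K[x][t] → K[[t]][x]`. -/
noncomputable def toPoly : K[X][X] →+* K⟦X⟧[X] :=
  (Polynomial.mapRingHom (algebraMap K[X] K⟦X⟧)).comp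
    (Polynomial.Bivariate.swap (R := K) : K[X][X] →+* K[X][X])

theorem toPoly_apply (p : K[X][X]) :
    toPoly p = (Polynomial.Bivariate.swap p).map (algebraMap K[X] K⟦X⟧) := rfl

theorem ofPoly_C (s : K⟦X⟧) : ofPoly (Polynomial.C s) = const s := by simp [ofPoly]

theorem ofPoly_X : ofPoly (Polynomial.X : K⟦X⟧[X]) = x := by simp [ofPoly]

theorem algebraMap_apply_eq_coe (p : K[X]) : algebraMap K[X] K⟦X⟧ p = (p : K⟦X⟧) := rfl

theorem toPoly_C_C (a : K) :
    toPoly (Polynomial.C (Polynomial.C a)) = Polynomial.C (C a) := by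
  rw [toPoly_apply, Polynomial.Bivariate.swap_C_C, Polynomial.map_C, algebraMap_apply_eq_coe,
    Polynomial.coe_C]

theorem toPoly_C_X : toPoly (Polynomial.C Polynomial.X : K[X][X]) = Polynomial.X := by
  rw [toPoly_apply, Polynomial.Bivariate.swap_X, Polynomial.map_X]

theorem toPoly_X : toPoly (Polynomial.X : K[X][X]) = Polynomial.C X := by
  rw [toPoly_apply, Polynomial.Bivariate.swap_Y, Polynomial.map_C, algebraMap_apply_eq_coe,
    Polynomial.coe_X]

theorem ofPoly_toPoly (p : K[X][X]) : ofPoly (toPoly p) = coePS p := by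
  have : (ofPoly.comp toPoly : K[X][X] →+* K[X]⟦X⟧) = coePS := by
    refine Polynomial.ringHom_ext' (Polynomial.ringHom_ext' ?_ ?_) ?_
    · ext1 a
      simp [toPoly_C_C, ofPoly_C, const]
    · simp [toPoly_C_X, ofPoly_X, x]
    · simp [toPoly_X, ofPoly_C, const]
  exact congrArg (fun φ : K[X][X] →+* K[X]⟦X⟧ => φ p) this

theorem map_constantCoeff_toPoly (p : K[X][X]) :
    (toPoly p).map PowerSeries.constantCoeff = p.eval 0 := by
  have : ((Polynomial.mapRingHom PowerSeries.constantCoeff).comp toPoly : K[X][X] →+* K[X]) =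
      Polynomial.evalRingHom 0 := by
    refine Polynomial.ringHom_ext' (Polynomial.ringHom_ext' ?_ ?_) ?_
    · ext1 a
      simp [toPoly_C_C]
    · simp [toPoly_C_X]
    · simp [toPoly_X]
  exact congrArg (fun φ : K[X][X] →+* K[X] => φ p) this

theorem coeff_coeff_ofPoly (p : K⟦X⟧[X]) (m i : ℕ) :
    (coeff m (ofPoly p)).coeff i = coeff m (p.coeff i) := by
  induction p using Polynomial.induction_on' with
  | add p q hp hq => simp [hp, hq]
  | monomial j s =>
    rw [← Polynomial.C_mul_X_pow_eq_monomial, map_mul, map_pow, ofPoly_C, ofPoly_X, x, ← map_pow,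
      PowerSeries.coeff_mul_C, const, PowerSeries.coeff_map, Polynomial.coeff_C_mul_X_pow,
      Polynomial.coeff_C_mul_X_pow]
    split_ifs <;> simp

theorem coeff_zero_ofPoly (p : K⟦X⟧[X]) :
    coeff 0 (ofPoly p) = p.map PowerSeries.constantCoeff := by
  ext i
  rw [coeff_coeff_ofPoly, Polynomial.coeff_map, PowerSeries.coeff_zero_eq_constantCoeff_apply]

theorem ofPoly_injective : Function.Injective (ofPoly : K⟦X⟧[X] → K[X]⟦X⟧) := by
  intro p q h
  ext i m
  rw [← coeff_coeff_ofPoly, h, coeff_coeff_ofPoly]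

/-- Divisibility by a distinguished polynomial in `K[x][[t]]` descends to `K[[t]][x]`. -/
theorem dvd_of_ofPoly_dvd {W p : K⟦X⟧[X]} (hW : W.Monic)
    (hbar : W.map PowerSeries.constantCoeff = Polynomial.X ^ W.natDegree)
    (h : ofPoly W ∣ ofPoly p) : W ∣ p := by
  rw [← Polynomial.modByMonic_eq_zero_iff_dvd hW]
  obtain ⟨g, hg⟩ : ofPoly W ∣ ofPoly (p %ₘ W) := by
    rw [Polynomial.modByMonic_eq_sub_mul_div, map_sub, map_mul]
    exact dvd_sub h (dvd_mul_right _ _)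
  suffices hg0 : g = 0 by
    apply ofPoly_injective
    rw [hg, hg0, mul_zero, map_zero]
  ext1 m
  rw [map_zero]
  induction m using Nat.strong_induction_on with
  | _ m ih =>
    have h1 := congrArg (coeff m) hg
    -- Since the lower coefficients of `g` vanish, the t^m coefficient of the remainder is x^(deg W)
    -- times that of `g`, while its degree in x is below deg W.
    rw [PowerSeries.coeff_mul, Finset.sum_eq_single (0, m), coeff_zero_ofPoly, hbar] at h1
    · by_contra hne
      have h2 : (coeff m (ofPoly (p %ₘ W))).coeff (W.natDegree + (coeff m g).natDegree) = 0 := by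
        rw [coeff_coeff_ofPoly, Polynomial.coeff_eq_zero_of_degree_lt, map_zero]
        refine (Polynomial.degree_modByMonic_lt p hW).trans_le ?_
        rw [Polynomial.degree_eq_natDegree hW.ne_zero]
        exact_mod_cast Nat.le_add_right _ _
      rw [h1, add_comm, Polynomial.coeff_X_pow_mul] at h2
      exact hne (Polynomial.leadingCoeff_eq_zero.mp h2)
    · rintro ⟨i, j⟩ hij hne
      rw [Finset.HasAntidiagonal.mem_antidiagonal] at hij
      have : i ≠ 0 := by rintro rfl; exact hne (by simpa using hij)
      rw [ih j (by simp only at hij; omega), mul_zero]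
    · intro hn; simp at hn

theorem isUnit_ofPoly {u : K⟦X⟧[X]} (hu : u.map (PowerSeries.constantCoeff (R := K)) = 1) :
    IsUnit (ofPoly u) := by
  rw [PowerSeries.isUnit_iff_constantCoeff, ← PowerSeries.coeff_zero_eq_constantCoeff_apply,
    coeff_zero_ofPoly, hu]
  exact isUnit_one

/-- Here `K[X]` plays the role of K[t]; it embeds in K[x][t] by applying `Polynomial.C` to
coefficients. -/
theorem isAlgebraic_const {s : K⟦X⟧} (hs : IsAlgebraic K[X] s) : IsAlgebraic K[X][X] (const s) := by
  have hcoe : ∀ p : K[X][X], algebraMap K[X][X] K[X]⟦X⟧ p = (p : K[X]⟦X⟧) := fun _ => rfl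
  refine hs.ringHom_of_comp_eq (Polynomial.mapRingHom (Polynomial.C : K →+* K[X])) const
    (Polynomial.map_injective _ Polynomial.C_injective) ?_
  refine Polynomial.ringHom_ext' ?_ ?_
  · ext1 a
    simp [algebraMap_apply_eq_coe, const, hcoe]
  · simp [algebraMap_apply_eq_coe, const, hcoe]

/-- Division by a monic polynomial commutes with base change, so it can be done over the subring of
algebraic series. -/
theorem isAlgebraic_coeff_modByMonic {W : K⟦X⟧[X]} (hW : W.Monic)
    (halg : ∀ i, IsAlgebraic K[X] (W.coeff i)) (p : K[X][X]) (i : ℕ) :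
    IsAlgebraic K[X] ((toPoly p %ₘ W).coeff i) := by
  let A := Subalgebra.algebraicClosure K[X] K⟦X⟧
  have hlift : W ∈ Polynomial.lifts (algebraMap A K⟦X⟧) :=
    (Polynomial.lifts_iff_coeff_lifts _).mpr fun i => ⟨⟨W.coeff i, halg i⟩, rfl⟩
  obtain ⟨W', hW', -, hmonic⟩ := Polynomial.lifts_and_degree_eq_and_monic hlift hW
  have h : toPoly p %ₘ W =
      (((Polynomial.Bivariate.swap p).map (algebraMap K[X] A)) %ₘ W').map (algebraMap A K⟦X⟧) := by
    rw [Polynomial.map_modByMonic _ hmonic, hW', Polynomial.map_map,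
      ← IsScalarTower.algebraMap_eq, toPoly_apply]
  rw [h, Polynomial.coeff_map]
  exact (((Polynomial.Bivariate.swap p).map (algebraMap K[X] A) %ₘ W').coeff i).2

/-! ### The linear system modulo W and algebraicity of the solution -/

section System

variable {n k : ℕ}

/-- If the remainders of the combinations `∑ r_J c_J` modulo `W` determine `r`, then a solution
`r` of an inhomogeneous system of congruences modulo `W` is algebraic. -/
theorem isAlgebraic_of_dvd_sub_sum {J : Type*} [Fintype J] {W : K⟦X⟧[X]} (hW : W.Monic)
    (halg : ∀ i, IsAlgebraic K[X] (W.coeff i)) (c : J → Fin n → K[X][X]) (b : Fin n → K[X][X])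
    (hinj : ∀ v : J → K⟦X⟧,
      (∀ l, W ∣ ∑ q, Polynomial.C (v q) * toPoly (c q l)) → v = 0)
    (r : J → K⟦X⟧) (hr : ∀ l, W ∣ toPoly (b l) - ∑ q, Polynomial.C (r q) * toPoly (c q l))
    (q : J) : IsAlgebraic K[X] (r q) := by
  classical
  let A := Subalgebra.algebraicClosure K[X] K⟦X⟧
  -- One equation for each component and each power of x below deg W.
  let M : Matrix (Fin n × Fin W.natDegree) J A := Matrix.of fun p q =>
    ⟨(toPoly (c q p.1) %ₘ W).coeff p.2, isAlgebraic_coeff_modByMonic hW halg _ _⟩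
  let b' : Fin n × Fin W.natDegree → A := fun p =>
    ⟨(toPoly (b p.1) %ₘ W).coeff p.2, isAlgebraic_coeff_modByMonic hW halg _ _⟩
  have hsum : ∀ (v : J → K⟦X⟧) l, (∑ q, Polynomial.C (v q) * toPoly (c q l)) %ₘ W =
      ∑ q, Polynomial.C (v q) * (toPoly (c q l) %ₘ W) := fun v l => by
    rw [← Polynomial.modByMonicHom_apply, map_sum]
    refine Finset.sum_congr rfl fun q _ => ?_
    rw [Polynomial.modByMonicHom_apply, ← Polynomial.smul_eq_C_mul, Polynomial.smul_modByMonic,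
      Polynomial.smul_eq_C_mul]
  have hMv : ∀ (v : J → K⟦X⟧) p, (M.map (algebraMap A K⟦X⟧)).mulVec v p =
      ((∑ q, Polynomial.C (v q) * toPoly (c q p.1)) %ₘ W).coeff p.2 := fun v p => by
    rw [hsum, Polynomial.finsetSum_coeff]
    simp only [Matrix.mulVec, dotProduct, Polynomial.coeff_C_mul]
    exact Finset.sum_congr rfl fun q _ => mul_comm _ _
  obtain ⟨d, hd, hdr⟩ := exists_mul_eq_algebraMap_of_mulVec_eq M (fun v hv => by
    have h0 : (fun q => algebraMap A K⟦X⟧ (v q)) = 0 := by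
      refine hinj _ fun l => ?_
      rw [← Polynomial.modByMonic_eq_zero_iff_dvd hW]
      ext1 i
      rw [Polynomial.coeff_zero]
      by_cases hi : i < W.natDegree
      · have h1 := hMv (fun q => algebraMap A K⟦X⟧ (v q)) (l, ⟨i, hi⟩)
        rw [← h1]
        have h2 := congrArg (algebraMap A K⟦X⟧) (congrFun hv (l, ⟨i, hi⟩))
        simpa [Matrix.mulVec, dotProduct] using h2
      · refine Polynomial.coeff_eq_zero_of_degree_lt
          ((Polynomial.degree_modByMonic_lt _ hW).trans_le ?_)
        rw [Polynomial.degree_eq_natDegree hW.ne_zero]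
        exact_mod_cast not_lt.mp hi
    funext q
    exact Subtype.val_injective (congrFun h0 q)) b' r (funext fun p => by
      rw [hMv]
      have h := (Polynomial.modByMonic_eq_zero_iff_dvd hW).mpr (hr p.1)
      rw [Polynomial.sub_modByMonic, sub_eq_zero] at h
      rw [← h]
      rfl)
  obtain ⟨e, he⟩ := hdr q
  refine IsAlgebraic.of_mul (mem_nonZeroDivisors_of_ne_zero (x := algebraMap A K⟦X⟧ d) ?_) d.2 ?_
  · exact fun h => hd (Subtype.val_injective h)
  · rw [he]; exact e.2

variable (B : Fin (k + 1) → Matrix (Fin n) (Fin n) K[X][X])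

theorem kernelOp_sum {J : Type*} [Fintype J] (s : J → K⟦X⟧) (e : J → Fin n → K[X]⟦X⟧) (j : Fin n) :
    kernelOp B (fun l => ∑ q, const (s q) * e q l) j = ∑ q, const (s q) * kernelOp B (e q) j := by
  have h : (fun l => ∑ q, const (s q) * e q l) = ∑ q, fun l => const (s q) * e q l := by
    funext l; simp
  rw [h, map_sum, Finset.sum_apply]
  exact Finset.sum_congr rfl fun q _ => kernelOp_const_mul B _ _ _

theorem isAlgebraic_of_kernelOp_eq (a : Fin n → K[X][X]) (f : Fin n → K[X]⟦X⟧)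
    (hf : kernelOp B f = fun j => coePS (a j)) (j : Fin n) : IsAlgebraic K[X][X] (f j) := by
  classical
  set P := kernelMatrix B
  set Ps := P.map coePS
  set Vs := P.adjugate.map (coePS (K := K))
  have hVP : Vs * Ps = coePS P.det • (1 : Matrix (Fin n) (Fin n) K[X]⟦X⟧) := by
    have h := congrArg (fun M : Matrix (Fin n) (Fin n) K[X][X] => M.map coePS) P.adjugate_mul
    simp only [Matrix.map_mul] at h
    rw [h]
    ext1 p q
    by_cases hpq : p = q <;> simp [hpq]
  have hPV : Ps * Vs = coePS P.det • (1 : Matrix (Fin n) (Fin n) K[X]⟦X⟧) := by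
    have h := congrArg (fun M : Matrix (Fin n) (Fin n) K[X][X] => M.map coePS) P.mul_adjugate
    simp only [Matrix.map_mul] at h
    rw [h]
    ext1 p q
    by_cases hpq : p = q <;> simp [hpq]
  have hDeval : P.det.eval 0 = (Polynomial.X : K[X]) ^ (k * n) := det_kernelMatrix_eval_zero B
  have hD0 : P.det ≠ 0 := by
    intro h
    rw [h, Polynomial.eval_zero] at hDeval
    exact pow_ne_zero _ Polynomial.X_ne_zero hDeval.symm
  have hDs0 : coePS P.det ≠ 0 := fun h => hD0 (Polynomial.coe_injective _ (by simpa using h))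
  obtain ⟨W, u, hW, hWu, hWbar, hubar, hdeg⟩ := exists_monic_factor (toPoly P.det) (k * n)
    (by rw [map_constantCoeff_toPoly, hDeval])
  rw [← hdeg] at hWbar
  obtain ⟨u', hu'⟩ := isUnit_ofPoly hubar
  have hDW : coePS P.det = ofPoly W * u' := by rw [← ofPoly_toPoly, hWu, map_mul, hu']
  -- After the swap of variables, det P is a polynomial in x over K[t], of which `W` is a factor
  -- over K[[t]].
  have halg : ∀ i, IsAlgebraic K[X] (W.coeff i) :=
    isAlgebraic_coeff_of_monic_dvd_map
      ((map_ne_zero_iff _ (Polynomial.Bivariate.swap (R := K)).injective).mpr hD0) hW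
      ⟨u, by rw [← hWu, toPoly_apply]⟩
  -- the images of the monomial vectors `x^i e_j`
  let mon : Fin n × Fin k → Fin n → K[X] := fun q => Pi.single q.1 (Polynomial.X ^ (q.2 : ℕ))
  choose y hy using fun q => exists_kernelOp_C B (mon q)
  let c : Fin n × Fin k → Fin n → K[X][X] := fun q => P.adjugate.mulVec (y q)
  let low : (Fin n × Fin k → K⟦X⟧) → Fin n → K[X]⟦X⟧ := fun r l =>
    ∑ i : Fin k, const (r (l, i)) * x ^ (i : ℕ)
  have hlow : ∀ r, low r = fun l => ∑ q, const (r q) * C (mon q l) := by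
    intro r
    funext l
    rw [Fintype.sum_prod_type, Finset.sum_eq_single l]
    · simp [low, mon, x]
    · intro l' _ hl'
      simp [mon, hl'.symm]
    · simp
  have hVlow : ∀ r l, Vs.mulVec (kernelOp B (low r)) l =
      ofPoly (∑ q, Polynomial.C (r q) * toPoly (c q l)) := by
    intro r l
    simp only [map_sum, map_mul, ofPoly_C, ofPoly_toPoly, c, Matrix.mulVec, dotProduct, Vs,
      Matrix.map_apply, hlow, kernelOp_sum, hy, Finset.mul_sum]
    rw [Finset.sum_comm]
    exact Finset.sum_congr rfl fun q _ => Finset.sum_congr rfl fun l' _ => by ring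
  -- division by the kernel matrix in terms of `W`
  have hinj : ∀ v : Fin n × Fin k → K⟦X⟧,
      (∀ l, W ∣ ∑ q, Polynomial.C (v q) * toPoly (c q l)) → v = 0 := by
    intro v hv
    choose g hg using hv
    -- The inverse unit makes det P · h equal to W · g.
    let h : Fin n → K[X]⟦X⟧ := fun l => ↑u'⁻¹ * ofPoly (g l)
    have h1 : Vs.mulVec (kernelOp B (low v)) = coePS P.det • h := by
      funext l
      rw [hVlow, hg, map_mul, Pi.smul_apply, smul_eq_mul, hDW]
      simp only [h]
      rw [mul_assoc, Units.mul_inv_cancel_left]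
    have h2 : kernelOp B (low v) = Ps.mulVec h := by
      have h3 := congrArg Ps.mulVec h1
      rw [Matrix.mulVec_mulVec, hPV, Matrix.mulVec_smul, Matrix.smul_mulVec,
        Matrix.one_mulVec] at h3
      exact smul_right_injective _ hDs0 h3
    rw [← kernelOp_x_pow_mul] at h2
    have h4 := kernelOp_injective B h2
    funext q
    have h5 := congrFun h4 q.1
    have h6 : low v q.1 =
        ofPoly (∑ i : Fin k, Polynomial.C (v (q.1, i)) * Polynomial.X ^ (i : ℕ)) := by
      simp [low, ofPoly_C, ofPoly_X]
    ext m
    -- The low part now equals x^k h; compare coefficients of x^i with i < k, which vanish on the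
    -- right.
    have h7 := congrArg (fun s => (coeff m s).coeff (q.2 : ℕ)) h5
    simp only [h6] at h7
    rw [coeff_coeff_ofPoly, x, ← map_pow, PowerSeries.coeff_C_mul, Polynomial.coeff_X_pow_mul',
      if_neg (not_le.mpr q.2.2), Polynomial.finsetSum_coeff, Finset.sum_eq_single q.2] at h7
    · simpa using h7
    · intro i _ hi
      rw [Polynomial.coeff_C_mul_X_pow, if_neg (fun h => hi (Fin.ext h.symm))]
    · simp
  let r : Fin n × Fin k → K⟦X⟧ := fun q => atZero (deltaPow q.2 (f q.1))
  let h : Fin n → K[X]⟦X⟧ := fun l => deltaPow k (f l)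
  have hfr : ∀ l, low r l + x ^ k * h l = f l := fun l => sum_add_x_pow_mul_deltaPow k (f l)
  have hPh : Ps.mulVec h = (fun l => coePS (a l)) - kernelOp B (low r) := by
    rw [← kernelOp_x_pow_mul, ← hf, ← map_sub]
    congr 1
    funext l
    rw [Pi.sub_apply, ← hfr l, add_sub_cancel_left]
  have hDh : ∀ l, coePS P.det * h l = ofPoly (toPoly (P.adjugate.mulVec a l) -
      ∑ q, Polynomial.C (r q) * toPoly (c q l)) := by
    intro l
    have h1 := congrFun (congrArg Vs.mulVec hPh) l
    rw [Matrix.mulVec_mulVec, hVP, Matrix.smul_mulVec, Matrix.one_mulVec, Matrix.mulVec_sub,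
      Pi.sub_apply, hVlow, Pi.smul_apply, smul_eq_mul] at h1
    rw [h1, map_sub, ofPoly_toPoly]
    congr 1
    simp only [Matrix.mulVec, dotProduct, Vs, Matrix.map_apply, map_sum, map_mul]
  have hr : ∀ q, IsAlgebraic K[X] (r q) :=
    isAlgebraic_of_dvd_sub_sum hW halg c (P.adjugate.mulVec a) hinj r fun l =>
      dvd_of_ofPoly_dvd hW hWbar ⟨u' * h l, by rw [← hDh, hDW, mul_assoc]⟩
  have hcoe : ∀ p : K[X][X], IsAlgebraic K[X][X] (coePS p) := fun p =>
    isAlgebraic_algebraMap (A := K[X]⟦X⟧) p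
  have hsum : ∀ {J : Type} [Fintype J] (s : J → K[X]⟦X⟧),
      (∀ q, IsAlgebraic K[X][X] (s q)) → IsAlgebraic K[X][X] (∑ q, s q) := fun s hs =>
    (Subalgebra.algebraicClosure K[X][X] K[X]⟦X⟧).sum_mem fun q _ => hs q
  have hxpow : ∀ i : ℕ, IsAlgebraic K[X][X] (x ^ i : K[X]⟦X⟧) := fun i => by
    have := hcoe (Polynomial.C (Polynomial.X ^ i))
    rwa [coePS_C, map_pow] at this
  have hh : IsAlgebraic K[X][X] (h j) := by
    refine IsAlgebraic.of_mul (mem_nonZeroDivisors_of_ne_zero hDs0) (hcoe _) ?_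
    rw [hDh, map_sub, map_sum, ofPoly_toPoly]
    refine (hcoe _).sub (hsum _ fun q => ?_)
    rw [map_mul, ofPoly_C, ofPoly_toPoly]
    exact (isAlgebraic_const (hr q)).mul (hcoe _)
  rw [← hfr j]
  exact (hsum _ fun i => (isAlgebraic_const (hr _)).mul (hxpow _)).add ((hxpow k).mul hh)

end System

end CatalyticSystem

theorem theorem2 {K : Type*} [Field K] [CharZero K] (n k : ℕ) (a : Fin n → K[X][X])
    (B : Fin (k + 1) → Matrix (Fin n) (Fin n) K[X][X]) :
    (∃! f : Fin n → K[X]⟦X⟧, CatalyticSystem.IsSolution a B f) ∧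
      ∀ f : Fin n → K[X]⟦X⟧, CatalyticSystem.IsSolution a B f →
        ∀ j : Fin n, IsAlgebraic K[X][X] (f j) := by
  simp only [CatalyticSystem.isSolution_iff]
  refine ⟨?_, fun f hf => CatalyticSystem.isAlgebraic_of_kernelOp_eq B a f hf⟩
  obtain ⟨f, hf⟩ := CatalyticSystem.kernelOp_surjective B fun j => CatalyticSystem.coePS (a j)
  exact ⟨f, hf, fun g hg => CatalyticSystem.kernelOp_injective B (hg.trans hf.symm)⟩
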